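/- Let $\tau$ be a random variable with values in $(0,\infty]$ and cumulative distribution function $F_\tau(t)=\mathbb{P}(\tau\le t)$, and let $Y$ be independent of $\tau$ and exponentially distributed with unit mean. For $r>0$ let $\sigma=Y/r$ (so $\mathbb{P}(\sigma>t)=e^{-rt}$ for $t\ge 0$) and $p=p(r)=\mathbb{P}(\tau<\sigma)$. Let $$T=\sum_{n=1}^{R}\sigma_n^-+\tau^-,$$ where $R,\sigma_1^-,\sigma_2^-,\dots,\tau^-$ are independent, $\mathbb{P}(R=n)=(1-p)^np$ for $n\in\{0,1,2,\dots\}$, each $\sigma_n^-$ has the law of $\sigma$ conditioned on $\sigma<\tau$, and $\tau^-$ has the law of $\tau$ conditioned on $\tau<\sigma$. If there are constants $d>0$ and $C>0$ such that $$\lim_{t\to0^+}t^d\ln F_\tau(t)=-C,$$ then $$\ln p\sim-\gamma r^{d/(d+1)}\quad\text{as }r\to\infty,$$ and, for every integer $m\ge1$, $\mathbb{E}[T^m]$ is finite for every $r>0$ and $$\ln\big(r^m\mathbb{E}[T^m]\big)\sim m\gamma r^{d/(d+1)}\quad\text{as }r\to\infty,$$ where $\gamma=\frac{d+1}{d^{d/(d+1)}}C^{1/(d+1)}>0$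 and $f\sim g$ means $f/g\to1$. -/

import Mathlib

open MeasureTheory ProbabilityTheory Filter Topology Asymptotics
open scoped ENNReal

noncomputable section

/-- The cumulative distribution function `F_τ(t) = ℙ(τ ≤ t)`, for `t ≥ 0`, of a random time `τ`
with values in `[0, ∞]`. -/
def timeCDF {Ω : Type*} [MeasurableSpace Ω] (P : Measure Ω) (τ : Ω → ℝ≥0∞) (t : ℝ) : ℝ :=
  P.real {ω | τ ω ≤ ENNReal.ofReal t}

/-- The probability `p = ℙ(τ < σ)` that the search (which takes time `τ`) ends before the
resetting time `σ`. -/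
def successProb {Ω : Type*} [MeasurableSpace Ω] (P : Measure Ω) (τ σ : Ω → ℝ≥0∞) : ℝ :=
  P.real {ω | τ ω < σ ω}

/-- The resetting time `σ = Y / r` at resetting rate `r > 0`. -/
def resetTime {Ω : Type*} (Y : Ω → ℝ) (r : ℝ) (ω : Ω) : ℝ≥0∞ :=
  ENNReal.ofReal (Y ω / r)

/-- `T` is a realization, on the probability space `(Ω', Q)`, of the first passage time under
resetting of a search whose duration without resetting is `τ` and whose resetting time is `σ`:
`T = ∑_{n=1}^{R} σ⁻_n + τ⁻`, where
* `R` is the number of unsuccessful searches, `Q(R = n) = (1 - p)^n p` with `p = ℙ(τ < σ)`;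
* the `σ⁻_n` have the law of `σ` conditioned on `σ < τ`;
* `τ⁻` has the law of `τ` conditioned on `τ < σ`;
* `R`, `σ⁻_1`, `σ⁻_2`, ..., `τ⁻` are independent.
The sequence is indexed from `0` here. -/
def IsResettingFPT {Ω Ω' : Type*} [MeasurableSpace Ω] [MeasurableSpace Ω']
    (P : Measure Ω) (τ σ : Ω → ℝ≥0∞) (Q : Measure Ω') (T : Ω' → ℝ≥0∞) : Prop :=
  ∃ (R : Ω' → ℕ) (σm : ℕ → Ω' → ℝ≥0∞) (τm : Ω' → ℝ≥0∞),
    Measurable R ∧ (∀ n, Measurable (σm n)) ∧ Measurable τm ∧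
    (∀ n : ℕ, Q.real {x | R x = n} = (1 - successProb P τ σ) ^ n * successProb P τ σ) ∧
    (∀ n, IdentDistrib (σm n) σ Q (cond P {ω | σ ω < τ ω})) ∧
    IdentDistrib τm τ Q (cond P {ω | τ ω < σ ω}) ∧
    iIndepFun σm Q ∧
    IndepFun τm (fun x n => σm n x) Q ∧
    IndepFun R (fun x => (τm x, fun n => σm n x)) Q ∧
    ∀ x, T x = (∑ n ∈ Finset.range (R x), σm n x) + τm x

end

/-! Since `Y` is exponential and independent of `τ`, `p(r)` is the Laplace transform of `τ` at `r`.
Heuristically `F(t) e^{-rt}` is `exp(-(rt + C t^{-d}))`, and the least value of `rt + C t^{-d}` over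
`t > 0` is `γ r^{d/(d+1)}`, attained at `t = (Cd/r)^{1/(d+1)}`. The lower bound on `p` evaluates at
this `t`. The upper bound cuts `Y` into unit intervals: about `δr` terms, each at most `exp(-γ₁
r^{d/(d+1)})` up to a constant with `γ₁` close to `γ`, and their number is lost in the logarithm
(`tendsto_log_div_rpow_of_laplace_bounds`).

For the moments, `r^m E[T^m]` lies between constant multiples of `p^{-m}` for large `r`. Above: the
power-mean inequality reduces `T^m` to powers of `R + 1` times single `m`-th powers; the geometric
law gives `E[(R+1)^j] ≤ j!/p^j`, and `σ⁻`, `τ⁻` have `m`-th moments at most `E[σ^m]` over the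
conditioning probability (`IsResettingFPT.lintegral_pow_succ_le`). Below: Jensen reduces to `E[T] ≥
E[R] E[σ⁻]`, with `E[R] = (1-p)/p` and `E[σ⁻]` at least a constant over `r`
(`IsResettingFPT.le_lintegral`). Taking logarithms finishes. -/

/-! ### The optimal exponent and the Tauberian theorem -/

/-- The minimum over `t > 0` of `t + C t^{-d}`. -/
noncomputable def youngConst (d C : ℝ) : ℝ := (d + 1) / d ^ (d / (d + 1)) * C ^ (1 / (d + 1))

lemma youngConst_pos {d C : ℝ} (hd : 0 < d) (hC : 0 < C) : 0 < youngConst d C := by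
  unfold youngConst; positivity

lemma continuousAt_youngConst {d C : ℝ} (hC : 0 < C) : ContinuousAt (youngConst d) C := by
  unfold youngConst
  exact continuousAt_const.mul (Real.continuousAt_rpow_const _ _ (Or.inl hC.ne'))

/-- Weighted AM-GM with weights `d/(d+1)` and `1/(d+1)`, each term being divided by its weight; with
these weights the powers of `t` cancel. -/
lemma youngConst_mul_rpow_le {d C r t : ℝ} (hd : 0 < d) (hC : 0 < C) (hr : 0 < r) (ht : 0 < t) :
    youngConst d C * r ^ (d / (d + 1)) ≤ r * t + C * t ^ (-d) := by
  have hd1 : 0 < d + 1 := by linarith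
  have h := Real.geom_mean_le_arith_mean2_weighted (w₁ := d / (d + 1)) (w₂ := 1 / (d + 1))
    (p₁ := r * t * ((d + 1) / d)) (p₂ := C * t ^ (-d) * (d + 1))
    (by positivity) (by positivity) (by positivity) (by positivity) (by field_simp)
  have e1 : d / (d + 1) * (r * t * ((d + 1) / d)) + 1 / (d + 1) * (C * t ^ (-d) * (d + 1))
      = r * t + C * t ^ (-d) := by field_simp
  rw [e1] at h
  refine le_trans (le_of_eq ?_) h
  have e2 : (t ^ (-d)) ^ (1 / (d + 1)) = (t ^ (d / (d + 1)))⁻¹ := by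
    rw [← Real.rpow_mul ht.le, ← Real.rpow_neg ht.le]; congr 1; ring
  have e3 : (d + 1) ^ (d / (d + 1)) * (d + 1) ^ (1 / (d + 1)) = d + 1 := by
    rw [← Real.rpow_add hd1, ← add_div, div_self hd1.ne', Real.rpow_one]
  have htp : 0 < t ^ (d / (d + 1)) := by positivity
  have hdp : 0 < d ^ (d / (d + 1)) := by positivity
  rw [Real.mul_rpow (by positivity) (by positivity), Real.mul_rpow hr.le ht.le,
    Real.div_rpow hd1.le hd.le, Real.mul_rpow (by positivity) hd1.le,
    Real.mul_rpow hC.le (by positivity), e2, youngConst]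
  have : ∀ a b : ℝ, r ^ (d / (d + 1)) * t ^ (d / (d + 1)) * (a / d ^ (d / (d + 1))) *
      (C ^ (1 / (d + 1)) * (t ^ (d / (d + 1)))⁻¹ * b)
      = (a * b) / d ^ (d / (d + 1)) * C ^ (1 / (d + 1)) * r ^ (d / (d + 1)) := by
    intro a b; field_simp
  rw [this, e3]

/-- The equality case at `r = 1`: the derivative `1 - C d s^{-d-1}` vanishes at `s = (C
d)^{1/(d+1)}`. -/
lemma youngConst_eq {d C : ℝ} (hd : 0 < d) (hC : 0 < C) :
    (C * d) ^ (1 / (d + 1)) + C * ((C * d) ^ (1 / (d + 1))) ^ (-d) = youngConst d C := by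
  have hd1 : 0 < d + 1 := by linarith
  have e1 : ((C * d) ^ (1 / (d + 1))) ^ (-d) = (C * d) ^ (1 / (d + 1)) / (C * d) := by
    rw [← Real.rpow_mul (by positivity), ← Real.rpow_sub_one (by positivity)]
    congr 1; field_simp; ring
  have e2 : d ^ (d / (d + 1)) = d / d ^ (1 / (d + 1)) := by
    rw [eq_div_iff (by positivity), ← Real.rpow_add hd, ← add_div, div_self hd1.ne', Real.rpow_one]
  rw [e1, youngConst, e2, Real.mul_rpow hC.le hd.le]
  field_simp

/-- An exponential Tauberian theorem: if `p r` is bounded from below and above by discretizations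
of the Laplace transform of `F`, and `log F t ~ -C t^{-d}` as `t → 0+`, then
`log (p r) ~ -γ r^{d/(d+1)}` as `r → ∞`. -/
theorem tendsto_log_div_rpow_of_laplace_bounds {F p : ℝ → ℝ} {d C : ℝ} (hd : 0 < d) (hC : 0 < C)
    (hFnn : ∀ t, 0 ≤ F t)
    (hF : Tendsto (fun t : ℝ => t ^ d * Real.log (F t)) (𝓝[>] 0) (𝓝 (-C)))
    (hlow : ∀ r > 0, ∀ t > 0, F t * Real.exp (-(r * t)) ≤ p r)
    (hup : ∀ r > 0, ∀ N : ℕ,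
      p r ≤ (∑ k ∈ Finset.range N, F ((k + 1) / r) * Real.exp (-k)) + Real.exp (-N))
    (hp : ∀ r > 0, 0 < p r) :
    Tendsto (fun r => Real.log (p r) / r ^ (d / (d + 1))) atTop (𝓝 (-youngConst d C)) := by
  have hd1 : 0 < d + 1 := by linarith
  have hα : 0 < d / (d + 1) := by positivity
  have hexp : 1 + -(1 / (d + 1)) = d / (d + 1) := by field_simp; ring
  have hneg : ∀ C1 < C, ∀ᶠ t in 𝓝[>] (0 : ℝ), Real.log (F t) ≤ -(C1 * t ^ (-d)) := by
    intro C1 hC1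
    filter_upwards [hF.eventually_lt_const (neg_lt_neg hC1), self_mem_nhdsWithin] with t ht ht0
    have ht0 : 0 < t := ht0
    have hdt : 0 < t ^ d := by positivity
    rw [Real.rpow_neg ht0.le, ← div_eq_mul_inv, ← neg_div, le_div_iff₀ hdt]
    linarith
  rw [tendsto_order]
  constructor
  · intro a ha
    set s := (C * d) ^ (1 / (d + 1)) with hs
    have hs0 : 0 < s := by positivity
    have hts : Tendsto (fun r : ℝ => s * r ^ (-(1 / (d + 1)))) atTop (𝓝[>] 0) := by
      rw [tendsto_nhdsWithin_iff]
      constructor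
      · simpa using (tendsto_rpow_neg_atTop (y := 1 / (d + 1)) (by positivity)).const_mul s
      · filter_upwards [eventually_gt_atTop 0] with r hr
        exact mul_pos hs0 (Real.rpow_pos_of_pos hr _)
    -- With `t = s r^{-1/(d+1)}`, this function is `(log F(t) - r t) / r^{d/(d+1)}`.
    have hlim : Tendsto (fun r : ℝ => -s + s ^ (-d) * ((s * r ^ (-(1 / (d + 1)))) ^ d *
        Real.log (F (s * r ^ (-(1 / (d + 1))))))) atTop (𝓝 (-s + s ^ (-d) * (-C))) :=
      ((hF.comp hts).const_mul _).const_add _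
    have hval : -s + s ^ (-d) * (-C) = -youngConst d C := by
      rw [← youngConst_eq hd hC, ← hs]; ring
    rw [hval] at hlim
    filter_upwards [hlim.eventually_const_lt ha, eventually_gt_atTop 0,
      hts.eventually (hneg (C / 2) (by linarith)), hts.eventually self_mem_nhdsWithin]
      with r hr hr0 hFr ht0
    refine hr.trans_le ?_
    set t := s * r ^ (-(1 / (d + 1))) with ht
    have ht0 : 0 < t := ht0
    -- `Real.log 0 = 0`, so a strictly negative bound on the logarithm excludes `F t = 0`; any
    -- constant in `(0, C)` would serve as well as `C / 2`.
    have hFt : 0 < F t := by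
      rcases (hFnn t).eq_or_lt with h | h
      · rw [← h, Real.log_zero] at hFr
        have : 0 < C / 2 * t ^ (-d) := by positivity
        linarith
      · exact h
    have h1 := Real.log_le_log (by positivity) (hlow r hr0 t ht0)
    rw [Real.log_mul hFt.ne' (Real.exp_ne_zero _), Real.log_exp] at h1
    rw [le_div_iff₀ (by positivity)]
    refine le_trans (le_of_eq ?_) h1
    have e1 : r * t = s * r ^ (d / (d + 1)) := by
      have : r ^ (d / (d + 1)) = r * r ^ (-(1 / (d + 1))) := by
        rw [← Real.rpow_one_add' hr0.le (hexp ▸ hα.ne'), hexp]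
      rw [this, ht]; ring
    have e2 : t ^ d = s ^ d * (r ^ (d / (d + 1)))⁻¹ := by
      rw [ht, Real.mul_rpow hs0.le (by positivity), ← Real.rpow_mul hr0.le,
        ← Real.rpow_neg hr0.le]
      congr 2; ring
    have hrp : 0 < r ^ (d / (d + 1)) := by positivity
    rw [e1, e2, Real.rpow_neg hs0.le]
    field_simp
    ring
  · intro a ha
    have hcont := (continuousAt_youngConst (d := d) hC).neg
    -- Lowering `C` slightly turns the asymptotics of `log F` into an inequality near `0`;
    -- continuity in `C` keeps the exponent within the margin `a`.
    obtain ⟨C1, ⟨hC1a, hC1pos⟩, hC1C⟩ : ∃ C1, (-youngConst d C1 < a ∧ 0 < C1) ∧ C1 < C := by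
      have h1 : ∀ᶠ x in 𝓝 C, -youngConst d x < a ∧ 0 < x :=
        (hcont.eventually_lt_const ha).and (eventually_gt_nhds hC)
      exact ((h1.filter_mono nhdsWithin_le_nhds).and
        (self_mem_nhdsWithin : Set.Iio C ∈ 𝓝[<] C)).exists
    set γ := youngConst d C1 with hγ
    obtain ⟨δ, hδ, hFδ⟩ : ∃ δ > 0, ∀ t ∈ Set.Ioc 0 δ, Real.log (F t) ≤ -(C1 * t ^ (-d)) := by
      obtain ⟨δ, hδ, h⟩ := mem_nhdsGT_iff_exists_Ioc_subset.1 (hneg C1 hC1C)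
      exact ⟨δ, hδ, h⟩
    have hbound : ∀ r > 0, ∀ t ∈ Set.Ioc 0 δ,
        F t * Real.exp (-(r * t)) ≤ Real.exp (-(γ * r ^ (d / (d + 1)))) := by
      intro r hr t ht
      rcases (hFnn t).eq_or_lt with h | h
      · rw [← h, zero_mul]; positivity
      · rw [← Real.exp_log h, ← Real.exp_add, Real.exp_le_exp]
        linarith [hFδ t ht, youngConst_mul_rpow_le hd hC1pos hr ht.1]
    have hev : ∀ᶠ r : ℝ in atTop, γ * r ^ (d / (d + 1)) ≤ δ * r := by
      filter_upwards [(tendsto_rpow_atTop (y := 1 / (d + 1)) (by positivity)).eventually_ge_atTop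
        (γ / δ), eventually_gt_atTop 0] with r hr hr0
      have e : r = r ^ (1 / (d + 1)) * r ^ (d / (d + 1)) := by
        rw [← Real.rpow_add hr0, ← add_div, add_comm 1 d, div_self hd1.ne', Real.rpow_one]
      calc γ * r ^ (d / (d + 1)) = δ * (γ / δ * r ^ (d / (d + 1))) := by field_simp
        _ ≤ δ * (r ^ (1 / (d + 1)) * r ^ (d / (d + 1))) := by gcongr
        _ = δ * r := by rw [← e]
    have hlogp : ∀ᶠ r : ℝ in atTop,
        Real.log (p r) / r ^ (d / (d + 1)) ≤
          (1 + Real.log (δ * r + 1)) / r ^ (d / (d + 1)) - γ := by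
      filter_upwards [hev, eventually_gt_atTop 0] with r hr hr0
      -- This `N` keeps every node `(k+1)/r` in `(0, δ]`, yet makes the tail `e^{-N}` as small as a
      -- term. The factor `e` in the bound pays for the shift from `k` to `k+1` and for the rounding
      -- of `δ r`.
      have hN : (⌊δ * r⌋₊ : ℝ) ≤ δ * r := Nat.floor_le (by positivity)
      have hN' : δ * r < ⌊δ * r⌋₊ + 1 := Nat.lt_floor_add_one _
      set N := ⌊δ * r⌋₊
      have hpr : p r ≤ (δ * r + 1) * Real.exp (1 - γ * r ^ (d / (d + 1))) := by
        refine (hup r hr0 N).trans ?_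
        have hterm : ∀ k ∈ Finset.range N, F ((k + 1) / r) * Real.exp (-k) ≤
            Real.exp (1 - γ * r ^ (d / (d + 1))) := by
          intro k hk
          have hk' : (k : ℝ) + 1 ≤ N := by exact_mod_cast Finset.mem_range.1 hk
          have := hbound r hr0 ((k + 1) / r) ⟨by positivity, by
            rw [div_le_iff₀ hr0]; linarith⟩
          have e : Real.exp (-(k : ℝ)) = Real.exp 1 * Real.exp (-(r * ((k + 1) / r))) := by
            rw [← Real.exp_add]; congr 1; field_simp; ring
          rw [e, sub_eq_add_neg, Real.exp_add 1]
          calc _ = Real.exp 1 * (F ((k + 1) / r) * Real.exp (-(r * ((k + 1) / r)))) := by ring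
            _ ≤ _ := by gcongr
        have hsum := Finset.sum_le_card_nsmul _ _ _ hterm
        rw [Finset.card_range, nsmul_eq_mul] at hsum
        have hlast : Real.exp (-(N : ℝ)) ≤ Real.exp (1 - γ * r ^ (d / (d + 1))) :=
          Real.exp_le_exp.2 (by linarith)
        nlinarith [Real.exp_pos (1 - γ * r ^ (d / (d + 1)))]
      have hl := Real.log_le_log (hp r hr0) hpr
      rw [Real.log_mul (by positivity) (Real.exp_ne_zero _), Real.log_exp] at hl
      have hrp : 0 < r ^ (d / (d + 1)) := by positivity
      rw [div_le_iff₀ hrp, sub_mul, div_mul_cancel₀ _ hrp.ne']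
      linarith
    have hlim : Tendsto (fun r : ℝ => (1 + Real.log (δ * r + 1)) / r ^ (d / (d + 1)) - γ)
        atTop (𝓝 (-γ)) := by
      have hu : Tendsto (fun r : ℝ => δ * r + 1) atTop atTop :=
        tendsto_atTop_add_const_right _ _ (tendsto_id.const_mul_atTop hδ)
      have h0 : Tendsto (fun r : ℝ => r ^ (d / (d + 1))) atTop atTop := tendsto_rpow_atTop hα
      have h1 : Tendsto (fun r : ℝ => Real.log (δ * r + 1) / r ^ (d / (d + 1))) atTop (𝓝 0) := by
        have h2 : (fun r : ℝ => Real.log (δ * r + 1)) =o[atTop]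
            fun r : ℝ => (δ * r + 1) ^ (d / (d + 1)) :=
          (isLittleO_log_rpow_atTop hα).comp_tendsto hu
        have h3 : (fun r : ℝ => (δ * r + 1) ^ (d / (d + 1))) =O[atTop]
            fun r : ℝ => r ^ (d / (d + 1)) := by
          refine IsBigO.of_bound ((δ + 1) ^ (d / (d + 1))) ?_
          filter_upwards [eventually_ge_atTop 1] with r hr
          rw [Real.norm_of_nonneg (by positivity), Real.norm_of_nonneg (by positivity),
            ← Real.mul_rpow (by positivity) (by positivity)]
          gcongr
          linarith
        exact (h2.trans_isBigO h3).tendsto_div_nhds_zero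
      simpa [add_div] using ((h0.const_div_atTop 1).add h1).sub_const γ
    filter_upwards [hlogp, hlim.eventually_lt_const hC1a] with r h1 h2 using h1.trans_lt h2

/-! ### Estimates for the exponential reset time -/

section Exponential

variable {Ω : Type*} [MeasurableSpace Ω] {P : Measure Ω} {τ : Ω → ℝ≥0∞} {Y : Ω → ℝ}

lemma measureReal_inter_of_indepFun {α β : Type*} [MeasurableSpace α] [MeasurableSpace β]
    {f : Ω → α} {g : Ω → β} (h : IndepFun f g P) {s : Set α} {t : Set β}
    (hs : MeasurableSet s) (ht : MeasurableSet t) :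
    P.real (f ⁻¹' s ∩ g ⁻¹' t) = P.real (f ⁻¹' s) * P.real (g ⁻¹' t) := by
  simp [measureReal_def, h.measure_inter_preimage_eq_mul s t hs ht]

lemma lintegral_pow_ne_top_of_hasLaw_exp (hYlaw : HasLaw Y (expMeasure 1) P) (m : ℕ) :
    ∫⁻ ω, ENNReal.ofReal (Y ω) ^ m ∂P ≠ ∞ := by
  rw [hYlaw.lintegral_comp (f := fun y => ENNReal.ofReal y ^ m) (by fun_prop), expMeasure,
    gammaMeasure, lintegral_withDensity_eq_lintegral_mul _ (by unfold gammaPDF; fun_prop)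
      (by fun_prop)]
  have hint := (Real.GammaIntegral_convergent (s := m + 1) (by positivity))
  refine ne_of_lt (lt_of_le_of_lt ?_ hint.lintegral_lt_top)
  rw [← lintegral_indicator measurableSet_Ioi]
  refine lintegral_mono_ae ?_
  -- The exponential density is nonzero at `0`, which `Ioi 0` omits; the point is null.
  filter_upwards [(Measure.ae_ne volume (0 : ℝ))] with y hy0
  have hpdf : gammaPDF 1 1 y = exponentialPDF 1 y := rfl
  rw [Pi.mul_apply, hpdf, exponentialPDF_eq]
  rcases lt_or_gt_of_ne hy0 with hy | hy
  · rw [if_neg (not_le.2 hy)]; simp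
  · rw [if_pos hy.le, Set.indicator_of_mem (Set.mem_Ioi.2 hy), ← ENNReal.ofReal_pow hy.le,
      ← ENNReal.ofReal_mul (by positivity)]
    simp

lemma lintegral_resetTime_pow {r : ℝ} (hr : 0 < r) (m : ℕ) :
    ∫⁻ ω, resetTime Y r ω ^ m ∂P
      = ENNReal.ofReal ((r ^ m)⁻¹) * ∫⁻ ω, ENNReal.ofReal (Y ω) ^ m ∂P := by
  rw [← lintegral_const_mul' _ _ ENNReal.ofReal_ne_top]
  refine lintegral_congr fun ω => ?_
  rw [resetTime, div_eq_inv_mul, ENNReal.ofReal_mul (by positivity), mul_pow,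
    ← ENNReal.ofReal_pow (by positivity), inv_pow]

variable [IsProbabilityMeasure P]

lemma measureReal_gt_of_hasLaw_exp (hY : Measurable Y) (hYlaw : HasLaw Y (expMeasure 1) P)
    {y : ℝ} (hy : 0 ≤ y) : P.real {ω | y < Y ω} = Real.exp (-y) := by
  have := isProbabilityMeasure_expMeasure one_pos
  have h : P.real {ω | Y ω ≤ y} = 1 - Real.exp (-y) := by
    have h1 := cdf_expMeasure_eq one_pos y
    rw [if_pos hy, one_mul, cdf_eq_real] at h1
    rw [hYlaw.measureReal_eq (p := fun x => x ≤ y) measurableSet_Iic]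
    exact h1
  have hc : {ω | y < Y ω} = {ω | Y ω ≤ y}ᶜ := by ext; simp
  rw [hc, probReal_compl_eq_one_sub (measurableSet_le hY measurable_const), h]
  ring

lemma timeCDF_mul_exp_le_successProb (hY : Measurable Y) (hYlaw : HasLaw Y (expMeasure 1) P)
    (hind : IndepFun τ Y P) {r t : ℝ} (hr : 0 < r) (ht : 0 < t) :
    timeCDF P τ t * Real.exp (-(r * t)) ≤ successProb P τ (resetTime Y r) := by
  rw [← measureReal_gt_of_hasLaw_exp hY hYlaw (by positivity : 0 ≤ r * t)]
  refine (measureReal_inter_of_indepFun hind (s := Set.Iic (ENNReal.ofReal t))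
    (t := Set.Ioi (r * t)) measurableSet_Iic measurableSet_Ioi).symm.trans_le
    (measureReal_mono fun ω hω => ?_)
  have h2 : r * t < Y ω := hω.2
  have h3 : t < Y ω / r := by rw [lt_div_iff₀ hr]; linarith
  exact lt_of_le_of_lt hω.1 ((ENNReal.ofReal_lt_ofReal_iff (ht.trans h3)).2 h3)

/-- If `τ < Y/r`, then either `Y > N`, or `k < Y ≤ k+1` for some `k < N`, whence `τ ≤ (k+1)/r`.
Independence factors each event. -/
lemma successProb_le_sum (hY : Measurable Y) (hYlaw : HasLaw Y (expMeasure 1) P)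
    (hind : IndepFun τ Y P) {r : ℝ} (hr : 0 < r) (N : ℕ) :
    successProb P τ (resetTime Y r) ≤
      (∑ k ∈ Finset.range N, timeCDF P τ ((k + 1) / r) * Real.exp (-k)) + Real.exp (-N) := by
  let A : ℕ → Set Ω := fun k =>
    τ ⁻¹' Set.Iic (ENNReal.ofReal ((k + 1) / r)) ∩ Y ⁻¹' Set.Ioi (k : ℝ)
  have hA : ∀ k, P.real (A k) = timeCDF P τ ((k + 1) / r) * Real.exp (-k) := fun k => by
    rw [← measureReal_gt_of_hasLaw_exp hY hYlaw (Nat.cast_nonneg k)]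
    exact measureReal_inter_of_indepFun hind measurableSet_Iic measurableSet_Ioi
  rw [← measureReal_gt_of_hasLaw_exp hY hYlaw (Nat.cast_nonneg N)]
  simp_rw [← hA]
  refine (measureReal_mono (s₂ := (⋃ k ∈ Finset.range N, A k) ∪ {ω | (N : ℝ) < Y ω}) ?_).trans
    ((measureReal_union_le _ _).trans
      (add_le_add_left (measureReal_biUnion_finset_le _ _) _))
  intro ω hω
  have hω : τ ω < ENNReal.ofReal (Y ω / r) := hω
  by_cases hN : (N : ℝ) < Y ω
  · exact Or.inr hN
  · have hpos : 0 < Y ω := by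
      have := ENNReal.ofReal_pos.1 (bot_le.trans_lt hω)
      exact (div_pos_iff_of_pos_right hr).1 this
    obtain ⟨k, hk⟩ := Nat.exists_eq_succ_of_ne_zero (Nat.ceil_pos.2 hpos).ne'
    refine Or.inl (Set.mem_biUnion (x := k) ?_ ⟨?_, ?_⟩)
    · have : ⌈Y ω⌉₊ ≤ N := Nat.ceil_le.2 (not_lt.1 hN)
      simp; omega
    · refine hω.le.trans (ENNReal.ofReal_le_ofReal ?_)
      have := Nat.le_ceil (Y ω)
      rw [hk] at this
      push_cast at this
      gcongr
    · exact Nat.lt_ceil.1 (show k < ⌈Y ω⌉₊ by omega)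

lemma measureReal_lt_time (hτ : Measurable τ) (t : ℝ) :
    P.real (τ ⁻¹' Set.Ioi (ENNReal.ofReal t)) = 1 - timeCDF P τ t := by
  have : τ ⁻¹' Set.Ioi (ENNReal.ofReal t) = {ω | τ ω ≤ ENNReal.ofReal t}ᶜ := by ext; simp
  rw [this, probReal_compl_eq_one_sub (measurableSet_le hτ measurable_const), timeCDF]

lemma le_measureReal_resetTime_lt (hτ : Measurable τ) (hY : Measurable Y)
    (hYlaw : HasLaw Y (expMeasure 1) P)
    (hind : IndepFun τ Y P) {r t : ℝ} (hr : 0 < r) (ht : 0 < t) :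
    (1 - timeCDF P τ t) * (1 - Real.exp (-(r * t))) ≤ P.real {ω | resetTime Y r ω < τ ω} := by
  have h : P.real (Y ⁻¹' Set.Iic (r * t)) = 1 - Real.exp (-(r * t)) := by
    rw [← measureReal_gt_of_hasLaw_exp hY hYlaw (by positivity : 0 ≤ r * t),
      ← probReal_compl_eq_one_sub (measurableSet_lt measurable_const hY)]
    congr 1; ext; simp
  rw [← h, ← measureReal_lt_time hτ, ← measureReal_inter_of_indepFun hind measurableSet_Ioi
    measurableSet_Iic]
  refine measureReal_mono fun ω hω => ?_
  have h2 : Y ω ≤ r * t := hω.2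
  refine lt_of_le_of_lt (ENNReal.ofReal_le_ofReal ?_) hω.1
  rw [div_le_iff₀ hr]; linarith

lemma successProb_add_le_one (hτ : Measurable τ) {σ : Ω → ℝ≥0∞} (hσ : Measurable σ) :
    successProb P τ σ + P.real {ω | σ ω < τ ω} ≤ 1 := by
  rw [successProb, ← measureReal_union _ (measurableSet_lt hσ hτ)]
  · exact measureReal_le_one
  · rw [Set.disjoint_left]
    exact fun ω (h1 : τ ω < σ ω) (h2 : σ ω < τ ω) => lt_asymm h1 h2

lemma measurable_resetTime (hY : Measurable Y) (r : ℝ) : Measurable (resetTime Y r) :=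
  (hY.div_const r).ennreal_ofReal

/-- On the event `τ > t`, `1 < Y ≤ 2`, one has `1/r ≤ σ ≤ 2/r ≤ t < τ`. -/
lemma le_setLIntegral_resetTime (hτ : Measurable τ) (hY : Measurable Y)
    (hYlaw : HasLaw Y (expMeasure 1) P)
    (hind : IndepFun τ Y P) {r t : ℝ} (hr : 0 < r) (hrt : 2 ≤ r * t) :
    ENNReal.ofReal ((1 - timeCDF P τ t) * (Real.exp (-1) - Real.exp (-2)) / r) ≤
      ∫⁻ ω in {ω | resetTime Y r ω < τ ω}, resetTime Y r ω ∂P := by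
  have h : P.real (Y ⁻¹' Set.Ioc 1 2) = Real.exp (-1) - Real.exp (-2) := by
    rw [← measureReal_gt_of_hasLaw_exp hY hYlaw zero_le_one,
      ← measureReal_gt_of_hasLaw_exp hY hYlaw zero_le_two, ← measureReal_sdiff _
        (measurableSet_lt measurable_const hY)]
    · congr 1; ext; simp
    · exact fun ω (h : 2 < Y ω) => one_lt_two.trans h
  rw [← h, ← measureReal_lt_time hτ, ← measureReal_inter_of_indepFun hind measurableSet_Ioi
    measurableSet_Ioc]
  set A := τ ⁻¹' Set.Ioi (ENNReal.ofReal t) ∩ Y ⁻¹' Set.Ioc 1 2 with hA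
  have hAm : MeasurableSet A := (hτ measurableSet_Ioi).inter (hY measurableSet_Ioc)
  have hsub : A ⊆ {ω | resetTime Y r ω < τ ω} := fun ω hω => by
    refine lt_of_le_of_lt (ENNReal.ofReal_le_ofReal ?_) hω.1
    rw [div_le_iff₀ hr]; linarith [hω.2.2]
  calc ENNReal.ofReal (P.real A / r) = ∫⁻ ω in A, ENNReal.ofReal (1 / r) ∂P := by
        rw [setLIntegral_const, ← ofReal_measureReal, ← ENNReal.ofReal_mul (by positivity)]
        congr 1; ring
    _ ≤ ∫⁻ ω in A, resetTime Y r ω ∂P := by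
        refine setLIntegral_mono (measurable_resetTime hY r) fun ω hω => ?_
        exact ENNReal.ofReal_le_ofReal (by gcongr; exact hω.2.1.le)
    _ ≤ _ := lintegral_mono_set hsub

end Exponential

/-! ### Random sums, geometric moments and power inequalities -/

lemma lintegral_comp_nat_of_indepFun {Ω β : Type*} [MeasurableSpace Ω] [MeasurableSpace β]
    {Q : Measure Ω} {R : Ω → ℕ} {Z : Ω → β} (hR : Measurable R) (hZ : Measurable Z)
    (h : IndepFun R Z Q) {f : ℕ → β → ℝ≥0∞} (hf : ∀ k, Measurable (f k)) :
    ∫⁻ x, f (R x) (Z x) ∂Q = ∑' k, Q {x | R x = k} * ∫⁻ x, f k (Z x) ∂Q := by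
  let g : ℕ → ℕ → ℝ≥0∞ := fun k => Set.indicator {k} 1
  have hg : ∀ k, Measurable (g k) := fun k => .of_discrete
  have e : ∀ x, f (R x) (Z x) = ∑' k, g k (R x) * f k (Z x) := fun x => by
    rw [tsum_eq_single (R x)]
    · simp [g]
    · intro k hk; simp [g, hk.symm]
  simp_rw [e]
  have hgf : ∀ k, AEMeasurable (fun x => g k (R x) * f k (Z x)) Q := fun k =>
    (((hg k).comp hR).mul ((hf k).comp hZ)).aemeasurable
  rw [lintegral_tsum hgf]
  refine tsum_congr fun k => ?_
  refine (lintegral_mul_eq_lintegral_mul_lintegral_of_indepFun'' ((hg k).comp hR).aemeasurable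
    ((hf k).comp hZ).aemeasurable (h.comp (hg k) (hf k))).trans ?_
  congr 1
  have : g k ∘ R = (R ⁻¹' {k}).indicator 1 := rfl
  rw [this, lintegral_indicator_one (hR (measurableSet_singleton k))]
  rfl

/-- Power-mean inequality for `k + 1` terms. It produces no cross moments. -/
lemma ENNReal.sum_add_pow_le (a : ℕ → ℝ≥0∞) (b : ℝ≥0∞) (k m : ℕ) :
    ((∑ n ∈ Finset.range k, a n) + b) ^ (m + 1) ≤
      (k + 1 : ℝ≥0∞) ^ m * ((∑ n ∈ Finset.range k, a n ^ (m + 1)) + b ^ (m + 1)) := by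
  let c : ℕ → ℝ≥0∞ := fun n => Nat.casesOn n b a
  have h := ENNReal.rpow_sum_le_const_mul_sum_rpow (Finset.range (k + 1)) c
    (p := (m + 1 : ℕ)) (by simp)
  simp only [ENNReal.rpow_natCast] at h
  rw [Finset.sum_range_succ', Finset.sum_range_succ'] at h
  simpa [c] using h

/-- Bound `(k+1)^j` by the rising factorial `(k+1)⋯(k+j) = j! (k+j choose j)`, whose geometric
series sums exactly. -/
lemma tsum_geometric_mul_succ_pow_le {p : ℝ} (hp : 0 < p) (hp1 : p ≤ 1) (j : ℕ) :
    ∑' k : ℕ, ENNReal.ofReal ((1 - p) ^ k * p) * (k + 1 : ℝ≥0∞) ^ j ≤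
      ENNReal.ofReal (j.factorial / p ^ j) := by
  have hq : 0 ≤ 1 - p := by linarith
  have hn : ‖1 - p‖ < 1 := by rw [Real.norm_of_nonneg hq]; linarith
  have hs := (hasSum_choose_mul_geometric_of_norm_lt_one j hn).mul_left (j.factorial * p)
  have hval : (j.factorial * p) * (1 / (1 - (1 - p)) ^ (j + 1)) = j.factorial / p ^ j := by
    rw [sub_sub_cancel]; field_simp; ring
  rw [hval] at hs
  rw [← hs.tsum_eq, ENNReal.ofReal_tsum_of_nonneg (fun k => by positivity) hs.summable]
  refine ENNReal.tsum_le_tsum fun k => ?_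
  have : (k + 1 : ℝ≥0∞) ^ j = ENNReal.ofReal (((k + 1) ^ j : ℕ) : ℝ) := by
    rw [ENNReal.ofReal_natCast]; push_cast; rfl
  rw [this, ← ENNReal.ofReal_mul (by positivity)]
  refine ENNReal.ofReal_le_ofReal ?_
  have h : (((k + 1) ^ j : ℕ) : ℝ) ≤ ((j.factorial * (k + j).choose j : ℕ) : ℝ) := by
    rw [← Nat.ascFactorial_eq_factorial_mul_choose]
    exact_mod_cast Nat.pow_succ_le_ascFactorial (k + 1) j
  push_cast at h ⊢
  calc _ ≤ (1 - p) ^ k * p * (j.factorial * (k + j).choose j) := by gcongr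
    _ = _ := by ring

lemma tsum_geometric_mul_coe {p : ℝ} (hp : 0 < p) (hp1 : p ≤ 1) :
    ∑' k : ℕ, ENNReal.ofReal ((1 - p) ^ k * p) * (k : ℝ≥0∞) = ENNReal.ofReal ((1 - p) / p) := by
  have hq : 0 ≤ 1 - p := by linarith
  have hn : ‖1 - p‖ < 1 := by rw [Real.norm_of_nonneg hq]; linarith
  have hs := (hasSum_coe_mul_geometric_of_norm_lt_one hn).mul_left p
  have hval : p * ((1 - p) / (1 - (1 - p)) ^ 2) = (1 - p) / p := by
    rw [sub_sub_cancel]; field_simp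
  rw [hval] at hs
  rw [← hs.tsum_eq, ENNReal.ofReal_tsum_of_nonneg (fun k => by positivity) hs.summable]
  refine tsum_congr fun k => ?_
  rw [← ENNReal.ofReal_natCast, ← ENNReal.ofReal_mul (by positivity)]
  congr 1; ring

lemma lintegral_pow_le_lintegral_pow {Ω : Type*} [MeasurableSpace Ω] {Q : Measure Ω}
    [IsProbabilityMeasure Q] {f : Ω → ℝ≥0∞} (hf : Measurable f) {m : ℕ} (hm : 1 ≤ m) :
    (∫⁻ x, f x ∂Q) ^ m ≤ ∫⁻ x, f x ^ m ∂Q := by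
  have hm0 : (m : ℝ) ≠ 0 := by positivity
  have h := eLpNorm'_le_eLpNorm'_of_exponent_le (p := 1) (q := m) one_pos (by exact_mod_cast hm) Q
    hf.aestronglyMeasurable
  simp only [eLpNorm', enorm_eq_self, ENNReal.rpow_one, div_one, ENNReal.rpow_natCast] at h
  calc _ ≤ ((∫⁻ x, f x ^ m ∂Q) ^ (1 / (m : ℝ))) ^ m := by gcongr
    _ = _ := by rw [← ENNReal.rpow_natCast, ← ENNReal.rpow_mul, one_div_mul_cancel hm0,
      ENNReal.rpow_one]

lemma lintegral_cond {Ω : Type*} [MeasurableSpace Ω] (P : Measure Ω) (s : Set Ω) (f : Ω → ℝ≥0∞) :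
    ∫⁻ ω, f ω ∂(cond P s) = (P s)⁻¹ * ∫⁻ ω in s, f ω ∂P := by
  rw [ProbabilityTheory.cond, lintegral_smul_measure, smul_eq_mul]

/-! ### Moment bounds for the resetting time -/

section ResettingFPT

variable {Ω Ω' : Type*} [MeasurableSpace Ω] [MeasurableSpace Ω'] {P : Measure Ω}
  {τ σ : Ω → ℝ≥0∞} {Q : Measure Ω'} {T : Ω' → ℝ≥0∞}

lemma IsResettingFPT.measurable (h : IsResettingFPT P τ σ Q T) : Measurable T := by
  obtain ⟨R, σm, τm, hR, hσm, hτm, -, -, -, -, -, -, hTeq⟩ := h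
  have : T = fun x => (∑ n ∈ Finset.range (R x), σm n x) + τm x := funext hTeq
  rw [this]
  refine Measurable.add ?_ hτm
  have h2 : Measurable fun z : Ω' × ℕ => ∑ n ∈ Finset.range z.2, σm n z.1 :=
    measurable_from_prod_countable_left fun k =>
      Finset.measurable_fun_sum (Finset.range k) fun n _ => hσm n
  exact h2.comp (measurable_id.prodMk hR)

variable [IsProbabilityMeasure P]

/-- Condition on `R`. The moment of `τ⁻` is controlled by that of `σ`, because `τ < σ` on the
conditioning event; hence `τ` itself needs no moments and may be infinite. -/
lemma IsResettingFPT.lintegral_pow_succ_le [IsFiniteMeasure Q] (h : IsResettingFPT P τ σ Q T)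
    (hσ : Measurable σ) (hp : 0 < successProb P τ σ) (m : ℕ) :
    ∫⁻ x, T x ^ (m + 1) ∂Q ≤
      (ENNReal.ofReal ((m + 1).factorial / successProb P τ σ ^ (m + 1)) * (P {ω | σ ω < τ ω})⁻¹ +
        ENNReal.ofReal (m.factorial / successProb P τ σ ^ m) * (P {ω | τ ω < σ ω})⁻¹) *
        ∫⁻ ω, σ ω ^ (m + 1) ∂P := by
  obtain ⟨R, σm, τm, hR, hσm, hτm, hRlaw, hσlaw, hτlaw, -, -, hRind, hTeq⟩ := h
  have hp1 : successProb P τ σ ≤ 1 := measureReal_le_one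
  set p := successProb P τ σ
  set s := ∫⁻ ω, σ ω ^ (m + 1) ∂P
  set a := (P {ω | σ ω < τ ω})⁻¹
  set b := (P {ω | τ ω < σ ω})⁻¹
  have hRk : ∀ k, Q {x | R x = k} = ENNReal.ofReal ((1 - p) ^ k * p) := fun k => by
    rw [← hRlaw, ofReal_measureReal]
  have hσi : ∀ n, ∫⁻ x, σm n x ^ (m + 1) ∂Q ≤ a * s := fun n => by
    have := ((hσlaw n).comp (u := fun y : ℝ≥0∞ => y ^ (m + 1)) (by fun_prop)).lintegral_eq
    simp only [Function.comp_def] at this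
    rw [this, lintegral_cond]
    gcongr
    exact setLIntegral_le_lintegral _ _
  have hτi : ∫⁻ x, τm x ^ (m + 1) ∂Q ≤ b * s := by
    have := (hτlaw.comp (u := fun y : ℝ≥0∞ => y ^ (m + 1)) (by fun_prop)).lintegral_eq
    simp only [Function.comp_def] at this
    rw [this, lintegral_cond]
    gcongr
    refine (setLIntegral_mono (hσ.pow_const _) fun ω hω => ?_).trans (setLIntegral_le_lintegral _ _)
    exact pow_le_pow_left' (le_of_lt hω) _
  have hZ : Measurable fun x => (τm x, fun n => σm n x) :=
    hτm.prodMk (measurable_pi_lambda _ hσm)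
  let f : ℕ → ℝ≥0∞ × (ℕ → ℝ≥0∞) → ℝ≥0∞ := fun k z =>
    (k + 1 : ℝ≥0∞) ^ m * ((∑ n ∈ Finset.range k, z.2 n ^ (m + 1)) + z.1 ^ (m + 1))
  have hf : ∀ k, Measurable (f k) := fun k => by fun_prop
  calc ∫⁻ x, T x ^ (m + 1) ∂Q ≤ ∫⁻ x, f (R x) (τm x, fun n => σm n x) ∂Q :=
        lintegral_mono fun x => by rw [hTeq]; exact ENNReal.sum_add_pow_le _ _ _ _
    _ = ∑' k, Q {x | R x = k} * ∫⁻ x, f k (τm x, fun n => σm n x) ∂Q :=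
        lintegral_comp_nat_of_indepFun hR hZ hRind hf
    _ ≤ ∑' k : ℕ, (ENNReal.ofReal ((1 - p) ^ k * p) * (k + 1 : ℝ≥0∞) ^ (m + 1) * (a * s) +
          ENNReal.ofReal ((1 - p) ^ k * p) * (k + 1 : ℝ≥0∞) ^ m * (b * s)) := by
        refine ENNReal.tsum_le_tsum fun k => ?_
        have hfk : ∫⁻ x, f k (τm x, fun n => σm n x) ∂Q ≤
            (k + 1 : ℝ≥0∞) ^ m * ((k + 1) * (a * s) + b * s) := by
          simp only [f]
          rw [lintegral_const_mul _ (by fun_prop), lintegral_add_right _ (by fun_prop),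
            lintegral_finsetSum _ (fun n _ => by fun_prop)]
          gcongr
          refine (Finset.sum_le_sum fun n _ => hσi n).trans ?_
          rw [Finset.sum_const, Finset.card_range, nsmul_eq_mul]
          gcongr
          exact le_self_add
        rw [hRk]
        refine (mul_le_mul_right hfk _).trans (le_of_eq ?_)
        ring
    _ ≤ _ := by
        rw [ENNReal.tsum_add, ENNReal.tsum_mul_right, ENNReal.tsum_mul_right, add_mul, mul_assoc,
          mul_assoc]
        gcongr
        · exact tsum_geometric_mul_succ_pow_le hp hp1 (m + 1)
        · exact tsum_geometric_mul_succ_pow_le hp hp1 m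

/-- Wald's identity after dropping `τ⁻`; the normalization of the conditional law is at least `1`
and is dropped too. -/
lemma IsResettingFPT.le_lintegral [IsFiniteMeasure Q] (h : IsResettingFPT P τ σ Q T)
    (hp : 0 < successProb P τ σ) :
    ENNReal.ofReal ((1 - successProb P τ σ) / successProb P τ σ) *
      ∫⁻ ω in {ω | σ ω < τ ω}, σ ω ∂P ≤ ∫⁻ x, T x ∂Q := by
  obtain ⟨R, σm, τm, hR, hσm, hτm, hRlaw, hσlaw, hτlaw, -, -, hRind, hTeq⟩ := h
  have hp1 : successProb P τ σ ≤ 1 := measureReal_le_one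
  set p := successProb P τ σ
  have hRk : ∀ k, Q {x | R x = k} = ENNReal.ofReal ((1 - p) ^ k * p) := fun k => by
    rw [← hRlaw, ofReal_measureReal]
  set e := ∫⁻ ω in {ω | σ ω < τ ω}, σ ω ∂P
  have hσi : ∀ n, e ≤ ∫⁻ x, σm n x ∂Q := fun n => by
    rw [(hσlaw n).lintegral_eq, lintegral_cond]
    exact le_mul_of_one_le_left zero_le (ENNReal.one_le_inv.2 prob_le_one)
  have hZ : Measurable fun x n => σm n x := measurable_pi_lambda _ hσm
  have hind : IndepFun R (fun x n => σm n x) Q := hRind.comp measurable_id measurable_snd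
  rw [← tsum_geometric_mul_coe hp hp1, ← ENNReal.tsum_mul_right]
  calc _ ≤ ∑' k, Q {x | R x = k} * ∫⁻ x, ∑ n ∈ Finset.range k, σm n x ∂Q := by
        refine ENNReal.tsum_le_tsum fun k => ?_
        rw [hRk, mul_assoc, lintegral_finsetSum _ (fun n _ => hσm n)]
        gcongr
        have := Finset.card_nsmul_le_sum (Finset.range k) _ e fun n _ => hσi n
        rwa [Finset.card_range, nsmul_eq_mul] at this
    _ = ∫⁻ x, ∑ n ∈ Finset.range (R x), σm n x ∂Q :=
        (lintegral_comp_nat_of_indepFun (f := fun k z => ∑ n ∈ Finset.range k, z n) hR hZ hind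
          fun k => by fun_prop).symm
    _ ≤ _ := lintegral_mono fun x => by rw [hTeq]; exact le_self_add

end ResettingFPT

/-! ### From two-sided bounds to logarithmic asymptotics -/

section Asymptotic

variable {α : Type*} {l : Filter α}

lemma tendsto_log_div_of_le_of_le_div_pow {p G x : α → ℝ} {k₁ k₂ γ : ℝ} {m : ℕ} (hk₁ : 0 < k₁)
    (hx : Tendsto x l atTop) (hp : ∀ᶠ r in l, 0 < p r)
    (hlow : ∀ᶠ r in l, k₁ / p r ^ m ≤ G r) (hup : ∀ᶠ r in l, G r ≤ k₂ / p r ^ m)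
    (hlim : Tendsto (fun r => Real.log (p r) / x r) l (𝓝 (-γ))) :
    Tendsto (fun r => Real.log (G r) / x r) l (𝓝 (m * γ)) := by
  have hk : ∀ k : ℝ, Tendsto (fun r => Real.log k / x r - m * (Real.log (p r) / x r)) l
      (𝓝 (m * γ)) := fun k => by
    simpa using (hx.const_div_atTop (Real.log k)).sub (hlim.const_mul (m : ℝ))
  have hlog : ∀ k q : ℝ, 0 < k → 0 < q → Real.log (k / q ^ m) = Real.log k - m * Real.log q :=
    fun k q hk hq => by rw [Real.log_div hk.ne' (by positivity), Real.log_pow]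
  refine tendsto_of_tendsto_of_tendsto_of_le_of_le' (hk k₁) (hk k₂) ?_ ?_
  · filter_upwards [hp, hlow, hx.eventually_gt_atTop 0] with r hpr h hxr
    rw [← mul_div_assoc, ← sub_div, ← hlog _ _ hk₁ hpr]
    gcongr
  · filter_upwards [hp, hlow, hup, hx.eventually_gt_atTop 0] with r hpr h h' hxr
    have hG : 0 < G r := lt_of_lt_of_le (by positivity) h
    have hk₂ : 0 < k₂ := by
      have := hG.trans_le h'
      rwa [div_pos_iff_of_pos_right (by positivity)] at this
    rw [← mul_div_assoc, ← sub_div, ← hlog _ _ hk₂ hpr]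
    gcongr

lemma isEquivalent_const_mul_of_tendsto_div {u x : α → ℝ} {c : ℝ} (hc : c ≠ 0)
    (h : Tendsto (fun r => u r / x r) l (𝓝 c)) : u ~[l] fun r => c * x r := by
  refine isEquivalent_of_tendsto_one ?_
  have h1 : u / (fun r => c * x r) = fun r => u r / x r / c := by
    ext r; simp only [Pi.div_apply]; rw [div_div, mul_comm]
  rw [h1]
  simpa [hc] using h.div_const c

end Asymptotic

/-- A single such time serves twice: `F t > 0` makes `p` positive, and `F t < 1` keeps the
probability of `σ < τ` away from `0` for large `r`. -/
lemma exists_mem_Ioo_of_tendsto_rpow_mul_log {F : ℝ → ℝ} {d C : ℝ} (hC : 0 < C)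
    (hFnn : ∀ t, 0 ≤ F t)
    (hF : Tendsto (fun t : ℝ => t ^ d * Real.log (F t)) (𝓝[>] 0) (𝓝 (-C))) :
    ∃ t > 0, F t ∈ Set.Ioo 0 1 := by
  obtain ⟨t, ht, ht0⟩ := ((hF.eventually_lt_const (neg_lt_zero.2 hC)).and
    self_mem_nhdsWithin).exists
  have ht0 : 0 < t := ht0
  have hlog : Real.log (F t) < 0 := by
    by_contra! h
    have : 0 ≤ t ^ d * Real.log (F t) := by positivity
    linarith
  have hpos : 0 < F t := (hFnn t).lt_of_ne' fun h => by simp [h] at hlog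
  exact ⟨t, ht0, hpos, not_le.1 fun h => (Real.log_nonneg h).not_gt hlog⟩

/-! ### Moment bounds as explicit multiples of `(r p)^{-m}` -/

section ResettingFPT

variable {Ω Ω' : Type*} [MeasurableSpace Ω] [MeasurableSpace Ω'] {P : Measure Ω}
  [IsProbabilityMeasure P] {τ : Ω → ℝ≥0∞} {Y : Ω → ℝ} {Q : Measure Ω'} {T : Ω' → ℝ≥0∞}

lemma IsResettingFPT.lintegral_pow_succ_le_ofReal [IsFiniteMeasure Q] {r : ℝ} (hr : 0 < r)
    (h : IsResettingFPT P τ (resetTime Y r) Q T) (hY : Measurable Y)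
    (hYlaw : HasLaw Y (expMeasure 1) P) (hp : 0 < successProb P τ (resetTime Y r))
    {q : ℝ} (hq : 0 < q) (hq' : q ≤ P.real {ω | resetTime Y r ω < τ ω}) (m : ℕ) :
    ∫⁻ x, T x ^ (m + 1) ∂Q ≤
      ENNReal.ofReal (((m + 1).factorial / q + m.factorial) *
        (∫⁻ ω, ENNReal.ofReal (Y ω) ^ (m + 1) ∂P).toReal /
          (r * successProb P τ (resetTime Y r)) ^ (m + 1)) := by
  refine (h.lintegral_pow_succ_le (measurable_resetTime hY r) hp m).trans ?_
  have hM := lintegral_pow_ne_top_of_hasLaw_exp hYlaw (m + 1)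
  have hA : (P {ω | resetTime Y r ω < τ ω})⁻¹ ≤ ENNReal.ofReal q⁻¹ := by
    rw [ENNReal.ofReal_inv_of_pos hq, ENNReal.inv_le_inv, ← ofReal_measureReal]
    exact ENNReal.ofReal_le_ofReal hq'
  have hB : (P {ω | τ ω < resetTime Y r ω})⁻¹ =
      ENNReal.ofReal (successProb P τ (resetTime Y r))⁻¹ := by
    rw [ENNReal.ofReal_inv_of_pos hp, successProb, ofReal_measureReal]
  rw [lintegral_resetTime_pow hr, hB]
  nth_rewrite 1 [← ENNReal.ofReal_toReal hM]
  set p := successProb P τ (resetTime Y r)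
  set M := (∫⁻ ω, ENNReal.ofReal (Y ω) ^ (m + 1) ∂P).toReal
  calc _ ≤ (ENNReal.ofReal ((m + 1).factorial / p ^ (m + 1)) * ENNReal.ofReal q⁻¹ +
        ENNReal.ofReal (m.factorial / p ^ m) * ENNReal.ofReal p⁻¹) *
        (ENNReal.ofReal (r ^ (m + 1))⁻¹ * ENNReal.ofReal M) := by gcongr
    _ = _ := by
      rw [← ENNReal.ofReal_mul (by positivity), ← ENNReal.ofReal_mul (by positivity),
        ← ENNReal.ofReal_mul (by positivity), ← ENNReal.ofReal_add (by positivity) (by positivity),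
        ← ENNReal.ofReal_mul (by positivity)]
      congr 1
      field_simp
      ring

/-- Jensen reduces to the mean; there `1 - p ≥ q` because `τ < σ` and `σ < τ` are disjoint. -/
lemma IsResettingFPT.ofReal_le_lintegral_pow [IsProbabilityMeasure Q] {r t : ℝ} (hr : 0 < r)
    (hrt : 2 ≤ r * t) (h : IsResettingFPT P τ (resetTime Y r) Q T) (hτ : Measurable τ)
    (hY : Measurable Y) (hYlaw : HasLaw Y (expMeasure 1) P) (hind : IndepFun τ Y P)
    (hp : 0 < successProb P τ (resetTime Y r))
    {q : ℝ} (hq' : q ≤ P.real {ω | resetTime Y r ω < τ ω}) {m : ℕ} (hm : 1 ≤ m)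
    (hq : 0 < q) (ht1 : timeCDF P τ t < 1) :
    ENNReal.ofReal ((q * ((1 - timeCDF P τ t) * (Real.exp (-1) - Real.exp (-2)))) ^ m /
      (r * successProb P τ (resetTime Y r)) ^ m) ≤ ∫⁻ x, T x ^ m ∂Q := by
  refine le_trans ?_ (lintegral_pow_le_lintegral_pow h.measurable hm)
  have h12 : Real.exp (-2) < Real.exp (-1) := Real.exp_lt_exp.2 (by norm_num)
  have hc : 0 < (1 - timeCDF P τ t) * (Real.exp (-1) - Real.exp (-2)) :=
    mul_pos (by linarith) (by linarith)
  have hqp : q ≤ 1 - successProb P τ (resetTime Y r) := by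
    linarith [successProb_add_le_one (P := P) hτ (measurable_resetTime hY r)]
  rw [← div_pow, ENNReal.ofReal_pow (by positivity)]
  gcongr
  refine le_trans ?_ (h.le_lintegral hp)
  refine le_trans ?_ (mul_le_mul_right (le_setLIntegral_resetTime hτ hY hYlaw hind hr hrt) _)
  rw [← ENNReal.ofReal_mul (div_nonneg (hq.le.trans hqp) hp.le)]
  refine ENNReal.ofReal_le_ofReal ?_
  set c := (1 - timeCDF P τ t) * (Real.exp (-1) - Real.exp (-2))
  set p := successProb P τ (resetTime Y r)
  calc q * c / (r * p) = q / p * (c / r) := by field_simp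
    _ ≤ _ := by gcongr

end ResettingFPT

/-! ### The main theorem -/

theorem theorem4
    {Ω : Type*} [MeasurableSpace Ω] (P : Measure Ω) [IsProbabilityMeasure P]
    -- search time without resetting, and the (rate one) exponential variable driving the resets
    (τ : Ω → ℝ≥0∞) (Y : Ω → ℝ) (hτ : Measurable τ) (hY : Measurable Y)
    (hYlaw : HasLaw Y (expMeasure 1) P) (hind : IndepFun τ Y P)
    -- first passage time under resetting at each rate `r > 0`, possibly on different spaces
    {Ω' : ℝ → Type*} [∀ r, MeasurableSpace (Ω' r)] (Q : ∀ r, Measure (Ω' r))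
    [∀ r, IsProbabilityMeasure (Q r)] (T : ∀ r, Ω' r → ℝ≥0∞)
    (hT : ∀ r, 0 < r → IsResettingFPT P τ (resetTime Y r) (Q r) (T r))
    (d C γ : ℝ) (hd : 0 < d) (hC : 0 < C)
    (hF : Tendsto (fun t : ℝ => t ^ d * Real.log (timeCDF P τ t)) (𝓝[>] 0) (𝓝 (-C)))
    (hγ : γ = (d + 1) / d ^ (d / (d + 1)) * C ^ (1 / (d + 1))) :
    0 < γ ∧
    (fun r : ℝ => Real.log (successProb P τ (resetTime Y r)))
      ~[atTop] (fun r => -γ * r ^ (d / (d + 1))) ∧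
    ∀ m : ℕ, 1 ≤ m →
      (∀ r, 0 < r → ∫⁻ x, T r x ^ m ∂(Q r) ≠ ∞) ∧
      (fun r : ℝ => Real.log (r ^ m * (∫⁻ x, T r x ^ m ∂(Q r)).toReal))
        ~[atTop] (fun r => m * γ * r ^ (d / (d + 1))) := by
  change γ = youngConst d C at hγ
  have hγ0 : 0 < γ := hγ ▸ youngConst_pos hd hC
  have hFnn : ∀ t, 0 ≤ timeCDF P τ t := fun t => measureReal_nonneg
  obtain ⟨t, ht0, hFt0, hFt1⟩ := exists_mem_Ioo_of_tendsto_rpow_mul_log hC hFnn hF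
  have hp : ∀ r > 0, 0 < successProb P τ (resetTime Y r) := fun r hr =>
    (mul_pos hFt0 (Real.exp_pos _)).trans_le
      (timeCDF_mul_exp_le_successProb hY hYlaw hind hr ht0)
  have hlim : Tendsto (fun r => Real.log (successProb P τ (resetTime Y r)) / r ^ (d / (d + 1)))
      atTop (𝓝 (-γ)) := hγ ▸ tendsto_log_div_rpow_of_laplace_bounds hd hC hFnn hF
    (fun r hr s hs => timeCDF_mul_exp_le_successProb hY hYlaw hind hr hs)
    (fun r hr N => successProb_le_sum hY hYlaw hind hr N) hp
  refine ⟨hγ0, isEquivalent_const_mul_of_tendsto_div (neg_ne_zero.2 hγ0.ne') hlim, ?_⟩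
  intro m hm
  obtain ⟨m, rfl⟩ := Nat.exists_eq_add_of_le' hm
  have hfin : ∀ r, 0 < r → ∫⁻ x, T r x ^ (m + 1) ∂(Q r) ≠ ∞ := fun r hr => by
    refine ne_top_of_le_ne_top ENNReal.ofReal_ne_top
      ((hT r hr).lintegral_pow_succ_le_ofReal hr hY hYlaw (hp r hr) ?_
        (le_measureReal_resetTime_lt hτ hY hYlaw hind hr ht0) m)
    have : Real.exp (-(r * t)) < 1 := Real.exp_lt_one_iff.2 (neg_lt_zero.2 (by positivity))
    exact mul_pos (by linarith) (by linarith)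
  refine ⟨hfin, isEquivalent_const_mul_of_tendsto_div (by positivity) ?_⟩
  have h12 : Real.exp (-2) < Real.exp (-1) := Real.exp_lt_exp.2 (by norm_num)
  have h01 : Real.exp (-2) < 1 := Real.exp_lt_one_iff.2 (by norm_num)
  -- Finiteness at a given `r` allowed a bound depending on `r`; the asymptotics need one uniform in
  -- `r`, obtained from `r t ≥ 2`.
  set q := (1 - timeCDF P τ t) * (1 - Real.exp (-2)) with hq
  have hq0 : 0 < q := mul_pos (by linarith) (by linarith)
  have hrt : ∀ᶠ r : ℝ in atTop, 2 ≤ r * t :=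
    (tendsto_id.atTop_mul_const ht0).eventually_ge_atTop 2
  have hqr : ∀ᶠ r : ℝ in atTop, q ≤ P.real {ω | resetTime Y r ω < τ ω} := by
    filter_upwards [hrt, eventually_gt_atTop 0] with r h hr
    refine le_trans ?_ (le_measureReal_resetTime_lt hτ hY hYlaw hind hr ht0)
    exact mul_le_mul_of_nonneg_left
      (sub_le_sub_left (Real.exp_le_exp.2 (by linarith)) _) (by linarith)
  refine tendsto_log_div_of_le_of_le_div_pow
    (p := fun r => successProb P τ (resetTime Y r))
    (k₁ := (q * ((1 - timeCDF P τ t) * (Real.exp (-1) - Real.exp (-2)))) ^ (m + 1))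
    (k₂ := ((m + 1).factorial / q + m.factorial) *
        (∫⁻ ω, ENNReal.ofReal (Y ω) ^ (m + 1) ∂P).toReal)
    ?_ (tendsto_rpow_atTop (by positivity)) ((eventually_gt_atTop 0).mono hp) ?_ ?_ hlim
  · exact pow_pos (mul_pos hq0 (mul_pos (by linarith) (by linarith))) _
  · filter_upwards [hrt, hqr, eventually_gt_atTop 0] with r h hqr hr
    have hpr := hp r hr
    have := (ENNReal.ofReal_le_iff_le_toReal (hfin r hr)).1
      ((hT r hr).ofReal_le_lintegral_pow hr h hτ hY hYlaw hind hpr hqr hm hq0 hFt1)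
    rw [mul_pow r, ← div_div, div_right_comm, div_le_iff₀' (by positivity)] at this
    exact this
  · filter_upwards [hqr, eventually_gt_atTop 0] with r hqr hr
    have hpr := hp r hr
    have := ENNReal.toReal_le_of_le_ofReal (by positivity)
      ((hT r hr).lintegral_pow_succ_le_ofReal hr hY hYlaw hpr hq0 hqr m)
    rw [mul_pow r, ← div_div, div_right_comm, le_div_iff₀' (by positivity)] at this
    exact this
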